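/- Let $\mathcal{A}$ and $\mathcal{B}$ be unital complex $C^*$-algebras, let $\mathcal{P}_{\mathcal{A}}$ and $\mathcal{P}_{\mathcal{B}}$ be their sets of pure states (the extreme points of the respective state spaces), and let $\varphi^\sharp : \mathcal{P}_{\mathcal{B}} \to \mathcal{P}_{\mathcal{A}}$ be an arbitrary map. Call two pure states $\omega_0, \omega_1$ of a $C^*$-algebra orthogonal if $\|\omega_0 - \omega_1\| = \|\omega_0\| + \|\omega_1\|$ (that is, $\|\omega_0-\omega_1\| = 2$) in the norm of the dual space, and unitarily equivalent if there is a unitary element $U$ of the algebra with $\omega_1(U^* a U) = \omega_0(a)$ for all elements $a$ of the algebra; let $[\omega]$ denote the unitary equivalence class of $\omega$ (containing $\omega$). Consider the following statements: 1. $\varphi^\sharp$ is co-orthogonal: for all $\omega_0, \omega_1 \in \mathcal{P}_{\mathcal{B}}$, if $\varphi^\sharp(\omega_0)$ and $\varphi^\sharp(\omega_1)$ are orthogonal, then $\omega_0$ and $\omega_1$ are orthogonal. 2. $\varphi^\sharp$ is locally co-orthogonal: for every $\omega \in \mathcal{P}_{\mathcal{B}}$ and all $\omega_0, \omega_1 \in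 [\omega]$, if $\varphi^\sharp(\omega_0)$ and $\varphi^\sharp(\omega_1)$ are orthogonal, then $\omega_0$ and $\omega_1$ are orthogonal. 3. $\varphi^\sharp$ is fibre-preserving: $\varphi^\sharp([\omega]) \subseteq [\varphi^\sharp(\omega)]$ for every $\omega \in \mathcal{P}_{\mathcal{B}}$. Then (1) and (2) are equivalent, and (2) implies (3). -/

import Mathlib

open scoped ComplexOrder

namespace PureStateMaps

/-- The states of a unital C⋆-algebra: positive functionals `ω` with `ω 1 = 1`
(for positive functionals this is the same as having norm one). -/
def states (A : Type*) [CStarAlgebra A] : Set (StrongDual ℂ A) :=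
  {ω | (∀ a : A, 0 ≤ ω (star a * a)) ∧ ω 1 = 1}

/-- The pure states: the extreme points of the state space. -/
def pureStates (A : Type*) [CStarAlgebra A] : Set (StrongDual ℂ A) :=
  Set.extremePoints ℝ (states A)

/-- Orthogonality with respect to the norm of the dual space. -/
def Orthogonal {A : Type*} [CStarAlgebra A] (ω₀ ω₁ : pureStates A) : Prop :=
  ‖(ω₀ : StrongDual ℂ A) - (ω₁ : StrongDual ℂ A)‖ =
    ‖(ω₀ : StrongDual ℂ A)‖ + ‖(ω₁ : StrongDual ℂ A)‖

/-- Unitary equivalence: `ω₁ (U⋆ a U) = ω₀ a` for some unitary `U` of the algebra itself. -/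
def UnitarilyEquivalent {A : Type*} [CStarAlgebra A] (ω₀ ω₁ : pureStates A) : Prop :=
  ∃ U ∈ unitary A, ∀ a : A,
    (ω₁ : StrongDual ℂ A) (star U * a * U) = (ω₀ : StrongDual ℂ A) a

/-- The unitary equivalence class `[ω]` of a pure state. -/
def fibre {A : Type*} [CStarAlgebra A] (ω : pureStates A) : Set (pureStates A) :=
  {ρ | UnitarilyEquivalent ω ρ}

/-- The restriction of `φ` to the set `S` of pure states is co-orthogonal. -/
def IsCoOrthogonalOn {A B : Type*} [CStarAlgebra A] [CStarAlgebra B]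
    (φ : pureStates B → pureStates A) (S : Set (pureStates B)) : Prop :=
  ∀ ω₀ ∈ S, ∀ ω₁ ∈ S, Orthogonal (φ ω₀) (φ ω₁) → Orthogonal ω₀ ω₁

/-- Co-orthogonality on all pure states. -/
def IsCoOrthogonal {A B : Type*} [CStarAlgebra A] [CStarAlgebra B]
    (φ : pureStates B → pureStates A) : Prop :=
  IsCoOrthogonalOn φ Set.univ

/-- Co-orthogonality of the restriction to each unitary equivalence class. -/
def IsLocallyCoOrthogonal {A B : Type*} [CStarAlgebra A] [CStarAlgebra B]
    (φ : pureStates B → pureStates A) : Prop :=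
  ∀ ω : pureStates B, IsCoOrthogonalOn φ (fibre ω)

/-- `φ` maps the class of `ω` into the class of `φ ω`. -/
def IsFibrePreserving {A B : Type*} [CStarAlgebra A] [CStarAlgebra B]
    (φ : pureStates B → pureStates A) : Prop :=
  ∀ ω : pureStates B, φ '' fibre ω ⊆ fibre (φ ω)

end PureStateMaps

namespace PureStateMaps

open scoped InnerProductSpace

/-! Two facts about pure states carry the theorem. (a) Pure states that are not orthogonal are
unitarily equivalent (`unitarilyEquivalent_of_not_orthogonal`). (b) Two equivalent pure states have
a third one in their class that is orthogonal to neither (`exists_fibre_not_orthogonal`).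

By (a), co-orthogonality can only fail for a pair inside one class, so the local condition implies
the global one. For fibre preservation, take equivalent `ω`, `ρ` and `σ` as in (b). By local
co-orthogonality, `φ σ` is orthogonal to neither `φ ω` nor `φ ρ`, so (a) makes all three images
equivalent.

For (a), the GNS representations are irreducible. If no nonzero intertwiner joins them, a
Kaplansky-type density argument gives a self-adjoint contraction in the algebra close to `1` on one
cyclic vector and to `-1` on the other, so the states are at distance 2. If there is one, Schur's
lemma makes one state a vector state in the GNS space of the other, and Kadison transitivity
supplies a unitary of the algebra itself. For (b), both states are vector states in one GNS space,
where some unit vector is orthogonal to neither vector; vector states of non-orthogonal vectors are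
at distance less than 2. -/

/-- `V` intertwines the representations `π` and `ρ`. -/
def Intertwines {A H K : Type*} [CStarAlgebra A]
    [NormedAddCommGroup H] [InnerProductSpace ℂ H] [CompleteSpace H]
    [NormedAddCommGroup K] [InnerProductSpace ℂ K] [CompleteSpace K]
    (π : A →⋆ₐ[ℂ] (H →L[ℂ] H)) (ρ : A →⋆ₐ[ℂ] (K →L[ℂ] K)) (V : H →L[ℂ] K) : Prop :=
  ∀ a x, V (π a x) = ρ a (V x)

theorem inner_rep_apply {A H : Type*} [CStarAlgebra A]
    [NormedAddCommGroup H] [InnerProductSpace ℂ H] [CompleteSpace H]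
    (π : A →⋆ₐ[ℂ] (H →L[ℂ] H)) (a : A) (x y : H) :
    ⟪π a x, y⟫_ℂ = ⟪x, π (star a) y⟫_ℂ := by
  rw [map_star, ContinuousLinearMap.star_eq_adjoint, ContinuousLinearMap.adjoint_inner_right]

/-! ### Von Neumann density on finitely many vectors -/

section Family

variable {A ι : Type*} [CStarAlgebra A] [Fintype ι] {H : ι → Type*}
  [∀ i, NormedAddCommGroup (H i)] [∀ i, InnerProductSpace ℂ (H i)] [∀ i, CompleteSpace (H i)]

/-- The direct sum of a finite family of representations. -/
noncomputable def diagRep (π : ∀ i, A →⋆ₐ[ℂ] (H i →L[ℂ] H i)) (a : A) (y : PiLp 2 H) : PiLp 2 H :=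
  WithLp.toLp 2 fun i => π i a (y i)

omit [Fintype ι] in
theorem continuous_diagRep (π : ∀ i, A →⋆ₐ[ℂ] (H i →L[ℂ] H i)) (a : A) :
    Continuous (diagRep π a) := by
  unfold diagRep
  fun_prop

theorem inner_diagRep (π : ∀ i, A →⋆ₐ[ℂ] (H i →L[ℂ] H i)) (a : A) (y z : PiLp 2 H) :
    ⟪diagRep π a y, z⟫_ℂ = ⟪y, diagRep π (star a) z⟫_ℂ := by
  simp [PiLp.inner_apply, diagRep, inner_rep_apply]

/-- The orbit map `a ↦ (π i a (x i))ᵢ`. -/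
noncomputable def orbitMap (π : ∀ i, A →⋆ₐ[ℂ] (H i →L[ℂ] H i)) (x : ∀ i, H i) :
    A →ₗ[ℂ] PiLp 2 H where
  toFun a := WithLp.toLp 2 fun i => π i a (x i)
  map_add' a b := by ext i; simp
  map_smul' c a := by ext i; simp

omit [Fintype ι] in
theorem diagRep_orbitMap (π : ∀ i, A →⋆ₐ[ℂ] (H i →L[ℂ] H i)) (x : ∀ i, H i) (a b : A) :
    diagRep π a (orbitMap π x b) = orbitMap π x (a * b) := by
  ext i; simp [diagRep, orbitMap]

/-- The closed orbit subspace is invariant under a self-adjoint family of operators, so its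
orthogonal complement is invariant too and the projection commutes with the family. -/
theorem starProjection_orbit_diagRep (π : ∀ i, A →⋆ₐ[ℂ] (H i →L[ℂ] H i)) (x : ∀ i, H i)
    (a : A) (y : PiLp 2 H) :
    (orbitMap π x).range.topologicalClosure.starProjection (diagRep π a y) =
      diagRep π a ((orbitMap π x).range.topologicalClosure.starProjection y) := by
  set K := (orbitMap π x).range.topologicalClosure with hK
  have hinv : ∀ b, ∀ z ∈ K, diagRep π b z ∈ K := by
    intro b z hz
    have : Set.MapsTo (diagRep π b) ((orbitMap π x).range : Set (PiLp 2 H))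
        ((orbitMap π x).range : Set (PiLp 2 H)) := by
      rintro _ ⟨c, rfl⟩
      exact ⟨b * c, (diagRep_orbitMap π x b c).symm⟩
    exact this.closure (continuous_diagRep π b) hz
  refine Submodule.eq_starProjection_of_mem_of_inner_eq_zero
    (hinv a _ (Submodule.starProjection_apply_mem _ _)) fun w hw => ?_
  have h1 : diagRep π a y - diagRep π a (K.starProjection y) =
      diagRep π a (y - K.starProjection y) := by
    ext i; simp [diagRep]
  rw [h1, inner_diagRep]
  exact Submodule.starProjection_inner_eq_zero _ _ (hinv _ _ hw)

/-- A von Neumann density theorem: operators commuting with all intertwiners are approximated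
by the algebra on finitely many vectors. -/
theorem mem_closure_orbit (π : ∀ i, A →⋆ₐ[ℂ] (H i →L[ℂ] H i)) (S : ∀ i, H i →L[ℂ] H i)
    (hS : ∀ i j (V : H i →L[ℂ] H j), Intertwines (π i) (π j) V → ∀ x, S j (V x) = V (S i x))
    (x : ∀ i, H i) :
    (WithLp.toLp 2 fun i => S i (x i)) ∈ (orbitMap π x).range.topologicalClosure := by
  classical
  set K := (orbitMap π x).range.topologicalClosure with hK
  let inc : ∀ i, H i →L[ℂ] PiLp 2 H := fun i =>
    ((PiLp.continuousLinearEquiv 2 ℂ H).symm : (∀ i, H i) →L[ℂ] PiLp 2 H) ∘L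
      ContinuousLinearMap.single ℂ H i
  have hinc : ∀ i v, inc i v = WithLp.toLp 2 (Pi.single i v) := fun i v => rfl
  -- The matrix entries of the projection onto the closed orbit; they are intertwiners because the
  -- projection commutes with the direct sum.
  let V : ∀ i j, H i →L[ℂ] H j := fun i j =>
    (PiLp.proj 2 H j : PiLp 2 H →L[ℂ] H j) ∘L K.starProjection ∘L inc i
  have hV : ∀ i j v, V i j v = (K.starProjection (inc i v)) j := fun i j v => rfl
  have hint : ∀ i j, Intertwines (π i) (π j) (V i j) := by
    intro i j a v
    have h1 : inc i (π i a v) = diagRep π a (inc i v) := by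
      ext k
      rw [hinc, hinc]
      rcases eq_or_ne i k with rfl | h
      · simp [diagRep]
      · simp [diagRep, Pi.single_eq_of_ne' h]
    rw [hV, h1, starProjection_orbit_diagRep]
    rfl
  have hsum : ∀ y : ∀ i, H i, ∀ j,
      (K.starProjection (WithLp.toLp 2 y)) j = ∑ i, V i j (y i) := by
    intro y j
    have : (WithLp.toLp 2 y : PiLp 2 H) = ∑ i, inc i (y i) := by
      ext k
      simp only [hinc, WithLp.ofLp_sum, Finset.sum_apply]
      simp [Finset.sum_pi_single]
    rw [this, map_sum, WithLp.ofLp_sum, Finset.sum_apply]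
    rfl
  have hx : K.starProjection (WithLp.toLp 2 x) = WithLp.toLp 2 x := by
    rw [Submodule.starProjection_eq_self_iff]
    refine Submodule.le_topologicalClosure _ ⟨1, ?_⟩
    ext i; simp [orbitMap]
  rw [← Submodule.starProjection_eq_self_iff]
  ext j
  rw [hsum]
  -- The vector `x` is fixed by the projection. Applying `S j` in coordinate `j` and moving it past
  -- each `V i j` shows that the image vector is fixed as well.
  have := congrArg (fun y => S j (y j)) hx
  simp only [hsum, map_sum] at this
  exact (Finset.sum_congr rfl fun i _ => (hS i j _ (hint i j) _).symm).trans this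

end Family

/-- The double orthogonal complement for the underlying real inner product; self-adjoint elements
form only a real subspace. -/
theorem mem_closure_of_re_inner_eq_zero {E : Type*} [NormedAddCommGroup E]
    [InnerProductSpace ℂ E] [CompleteSpace E] (M : Submodule ℝ E) (z : E)
    (h : ∀ u : E, (∀ m ∈ M, (⟪m, u⟫_ℂ).re = 0) → (⟪z, u⟫_ℂ).re = 0) : z ∈ closure (M : Set E) := by
  let _ : InnerProductSpace ℝ E := InnerProductSpace.complexToReal
  have hr : ∀ v w : E, ⟪v, w⟫_ℝ = (⟪v, w⟫_ℂ).re := fun v w => rfl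
  rw [← Submodule.topologicalClosure_coe, ← Submodule.orthogonal_orthogonal_eq_closure]
  refine (Submodule.mem_orthogonal' _ _).2 fun u hu => ?_
  rw [hr]
  exact h u fun m hm => by rw [← hr]; exact (Submodule.mem_orthogonal _ _).1 hu m hm

section Family

variable {A ι : Type*} [CStarAlgebra A] [Fintype ι] {H : ι → Type*}
  [∀ i, NormedAddCommGroup (H i)] [∀ i, InnerProductSpace ℂ (H i)] [∀ i, CompleteSpace (H i)]

/-- Self-adjoint operators commuting with all intertwiners are approximated by self-adjoint
elements of the algebra on finitely many vectors. -/
theorem exists_isSelfAdjoint_approx (π : ∀ i, A →⋆ₐ[ℂ] (H i →L[ℂ] H i)) (S : ∀ i, H i →L[ℂ] H i)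
    (hsa : ∀ i v w, ⟪S i v, w⟫_ℂ = ⟪v, S i w⟫_ℂ)
    (hS : ∀ i j (V : H i →L[ℂ] H j), Intertwines (π i) (π j) V → ∀ x, S j (V x) = V (S i x))
    (x : ∀ i, H i) {ε : ℝ} (hε : 0 < ε) :
    ∃ h : A, IsSelfAdjoint h ∧ ∀ i, ‖π i h (x i) - S i (x i)‖ < ε := by
  let M : Submodule ℝ (PiLp 2 H) :=
    (selfAdjoint.submodule ℝ A).map ((orbitMap π x).restrictScalars ℝ)
  have key : (WithLp.toLp 2 fun i => S i (x i)) ∈ closure (M : Set (PiLp 2 H)) := by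
    refine mem_closure_of_re_inner_eq_zero M _ fun u hu => ?_
    have h1 : ∀ a : A, (∑ i, (⟪π i a (x i), u i⟫_ℂ + ⟪π i a (u i), x i⟫_ℂ)).re = 0 := by
      intro a
      have h2 := hu (orbitMap π x (a + star a)) ⟨a + star a, IsSelfAdjoint.add_star_self a, rfl⟩
      rw [PiLp.inner_apply] at h2
      simp only [orbitMap, LinearMap.coe_mk, AddHom.coe_mk, map_add,
        WithLp.ofLp_add, Pi.add_apply, inner_add_left, Complex.re_sum, Complex.add_re] at h2 ⊢
      rw [← h2]
      refine Finset.sum_congr rfl fun i _ => ?_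
      rw [inner_rep_apply (π i) (star a), star_star, ← inner_conj_symm (x i), Complex.conj_re]
    -- Doubling the family lets the same algebra element act on `x` and on `u`. The relation `h1`
    -- then passes to the closure and holds for `S`; self-adjointness of `S` makes its two halves
    -- equal.
    let π' : ∀ p : ι × Bool, A →⋆ₐ[ℂ] (H p.1 →L[ℂ] H p.1) := fun p => π p.1
    let y : ∀ p : ι × Bool, H p.1 := fun p => bif p.2 then x p.1 else u p.1
    have h3 := mem_closure_orbit (ι := ι × Bool) (H := fun p => H p.1) π' (fun p => S p.1)
      (fun p q V hV => hS p.1 q.1 V hV) y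
    let g : PiLp 2 (fun p : ι × Bool => H p.1) → ℝ := fun z =>
      (∑ i, (⟪z (i, true), u i⟫_ℂ + ⟪z (i, false), x i⟫_ℂ)).re
    have hg : Continuous g := by
      refine Complex.continuous_re.comp (continuous_finsetSum _ fun i _ => ?_)
      fun_prop
    have h4 : Set.EqOn g 0 (closure ((orbitMap π' y).range : Set _)) := by
      refine Set.EqOn.closure ?_ hg continuous_const
      rintro _ ⟨a, rfl⟩
      exact h1 a
    have h5 : (∑ i, (⟪S i (x i), u i⟫_ℂ + ⟪S i (u i), x i⟫_ℂ)).re = 0 := h4 h3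
    rw [PiLp.inner_apply]
    simp only [Complex.re_sum, Complex.add_re] at h5 ⊢
    have h6 : ∀ i, (⟪S i (u i), x i⟫_ℂ).re = (⟪S i (x i), u i⟫_ℂ).re := fun i => by
      rw [hsa, ← inner_conj_symm, Complex.conj_re]
    simp only [h6, Finset.sum_add_distrib] at h5
    linarith
  obtain ⟨_, ⟨h, hh, rfl⟩, hd⟩ := Metric.mem_closure_iff.1 key ε hε
  refine ⟨h, hh, fun i => ?_⟩
  rw [dist_comm, dist_eq_norm] at hd
  exact (PiLp.norm_apply_le _ i).trans_lt hd

end Family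

/-! ### Norm control: Kaplansky density -/

/-- The resolvent-type functions used for norm control. -/
theorem exists_resolvent {A : Type*} [CStarAlgebra A] (a : A) (ha : IsSelfAdjoint a) :
    ∃ k h : A, IsSelfAdjoint h ∧ ‖k‖ ≤ 1 ∧ ‖h‖ ≤ 1 ∧ k * (1 + a * a) = 1 ∧ (1 + a * a) * k = 1 ∧
      h = 2 * (k * a) ∧ h = 2 * (a * k) := by
  have hc1 : Continuous fun t : ℝ => 1 / (1 + t * t) :=
    continuous_const.div (by fun_prop) fun t => by nlinarith [mul_self_nonneg t]
  have hc2 : Continuous fun t : ℝ => 1 + t * t := by fun_prop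
  have e2 : cfc (fun t : ℝ => 1 + t * t) a = 1 + a * a := by
    rw [cfc_add .., cfc_mul .., cfc_id' .., cfc_const_one ..]
  have hpos : ∀ t : ℝ, 0 < 1 + t * t := fun t => by nlinarith [mul_self_nonneg t]
  have e1 : cfc (fun t : ℝ => 1 / (1 + t * t)) a * (1 + a * a) = 1 := by
    rw [← e2, ← cfc_mul _ _ a hc1.continuousOn hc2.continuousOn]
    rw [show (fun t : ℝ => 1 / (1 + t * t) * (1 + t * t)) = fun _ => 1 from
      funext fun t => by have := hpos t; field_simp, cfc_const_one ..]
  have hcomm : ∀ f : ℝ → ℝ, Commute (cfc f a) a := fun f => by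
    simpa only [cfc_id ℝ a] using cfc_commute_cfc f id a
  -- Here `k = (1 + a²)⁻¹` and `h = 2a(1 + a²)⁻¹`; the bound on `h` is `|2t| ≤ 1 + t²`.
  refine ⟨cfc (fun t : ℝ => 1 / (1 + t * t)) a,
    2 * (cfc (fun t : ℝ => 1 / (1 + t * t)) a * a), ?_, ?_, ?_, e1, ?_, rfl, ?_⟩
  · have : IsSelfAdjoint (cfc (fun t : ℝ => 1 / (1 + t * t)) a) := cfc_predicate _ a
    rw [two_mul]
    exact (((this.commute_iff ha).1 (hcomm _))).add ((this.commute_iff ha).1 (hcomm _))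
  · refine norm_cfc_le zero_le_one fun t _ => ?_
    rw [Real.norm_eq_abs, abs_of_pos (by have := hpos t; positivity), div_le_one (hpos t)]
    nlinarith [mul_self_nonneg t]
  · have : 2 * (cfc (fun t : ℝ => 1 / (1 + t * t)) a * a) =
        cfc (fun t : ℝ => 2 * (1 / (1 + t * t) * t)) a := by
      rw [cfc_const_mul (2 : ℝ) _ a (by fun_prop), cfc_mul _ _ a hc1.continuousOn (by fun_prop),
        cfc_id' .., two_mul, two_smul]
    rw [this]
    refine norm_cfc_le zero_le_one fun t _ => ?_
    have := hpos t
    rw [Real.norm_eq_abs, show 2 * (1 / (1 + t * t) * t) = 2 * t / (1 + t * t) by ring, abs_le,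
      le_div_iff₀ this, div_le_one this]
    constructor <;> nlinarith [mul_self_nonneg (t - 1), mul_self_nonneg (t + 1)]
  · exact ((Commute.one_left _).add_left ((hcomm _).symm.mul_left (hcomm _).symm)).eq.trans e1
  · rw [(hcomm _).eq]

section Family

variable {A ι : Type*} [CStarAlgebra A] [Fintype ι] {H : ι → Type*}
  [∀ i, NormedAddCommGroup (H i)] [∀ i, InnerProductSpace ℂ (H i)] [∀ i, CompleteSpace (H i)]

theorem norm_rep_le {A H : Type*} [CStarAlgebra A]
    [NormedAddCommGroup H] [InnerProductSpace ℂ H] [CompleteSpace H]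
    (π : A →⋆ₐ[ℂ] (H →L[ℂ] H)) (a : A) (x : H) : ‖π a x‖ ≤ ‖a‖ * ‖x‖ :=
  ((π a).le_opNorm x).trans
    (mul_le_mul_of_nonneg_right (NonUnitalStarAlgHom.norm_apply_le π a) (norm_nonneg x))

/-- A Kaplansky density theorem: norm-controlled self-adjoint approximation of
`2 S (1 + S²)⁻¹` on finitely many vectors. -/
theorem exists_isSelfAdjoint_norm_le_one_approx (π : ∀ i, A →⋆ₐ[ℂ] (H i →L[ℂ] H i))
    (S k' h' : ∀ i, H i →L[ℂ] H i) (hsa : ∀ i v w, ⟪S i v, w⟫_ℂ = ⟪v, S i w⟫_ℂ)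
    (hS : ∀ i j (V : H i →L[ℂ] H j), Intertwines (π i) (π j) V → ∀ x, S j (V x) = V (S i x))
    (hk : ∀ i, (1 + S i * S i) * k' i = 1) (hh : ∀ i, h' i = 2 * (S i * k' i))
    (x : ∀ i, H i) {ε : ℝ} (hε : 0 < ε) :
    ∃ h : A, IsSelfAdjoint h ∧ ‖h‖ ≤ 1 ∧ ∀ i, ‖π i h (x i) - h' i (x i)‖ < ε := by
  let y : ∀ p : ι × Bool, H p.1 := fun p =>
    bif p.2 then k' p.1 (x p.1) else S p.1 (k' p.1 (x p.1))
  obtain ⟨a, ha, hay⟩ := exists_isSelfAdjoint_approx (ι := ι × Bool) (H := fun p => H p.1)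
    (fun p => π p.1) (fun p => S p.1) (fun p => hsa p.1) (fun p q V hV => hS p.1 q.1 V hV) y
    (show 0 < ε / 3 by positivity)
  obtain ⟨k, h, hhsa, hk1, hh1, hka, -, h1, h2⟩ := exists_resolvent a ha
  refine ⟨h, hhsa, hh1, fun i => ?_⟩
  have e1 : ‖π i a (k' i (x i)) - S i (k' i (x i))‖ < ε / 3 := hay (i, true)
  have e2 : ‖π i a (S i (k' i (x i))) - S i (S i (k' i (x i)))‖ < ε / 3 := hay (i, false)
  -- Resolvent identity: the difference involves `π i a - S i` only after `k'` or `S k'`, which is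
  -- why `y` consists of the vectors `k' x` and `S k' x`. The error is below `2ε/3 + ε/3`.
  have key : π i h - h' i = 2 * (π i k * (π i a * k' i - S i * k' i)) -
      π i h * (π i a * (S i * k' i) - S i * (S i * k' i)) := by
    have f1 : π i k * (1 + π i a * π i a) = 1 := by simpa using congrArg (π i) hka
    have f2 : π i h = 2 * (π i k * π i a) := by simp [h1, map_ofNat]
    have f3 : π i h = π i h * (1 + S i * S i) * k' i := by rw [mul_assoc, hk, mul_one]
    have f4 : h' i = 2 * (π i k * (1 + π i a * π i a) * (S i * k' i)) := by rw [f1, one_mul, hh]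
    have f5 : π i h = 2 * (π i k * π i a) * (1 + S i * S i) * k' i := by rw [← f2]; exact f3
    rw [f4]
    nth_rewrite 1 [f5]
    rw [f2]
    noncomm_ring
  have e3 : π i h (x i) - h' i (x i) =
      (2 : ℂ) • (π i k (π i a (k' i (x i)) - S i (k' i (x i)))) -
      π i h (π i a (S i (k' i (x i))) - S i (S i (k' i (x i)))) := by
    have := congrArg (fun T : H i →L[ℂ] H i => T (x i)) key
    rw [two_mul] at this
    rw [two_smul]
    exact this
  rw [e3]
  refine (norm_sub_le _ _).trans_lt ?_
  rw [norm_smul, Complex.norm_ofNat]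
  have g1 := norm_rep_le (π i) k (π i a (k' i (x i)) - S i (k' i (x i)))
  have g2 := norm_rep_le (π i) h (π i a (S i (k' i (x i))) - S i (S i (k' i (x i))))
  have g3 := mul_le_mul_of_nonneg_right hk1 (norm_nonneg (π i a (k' i (x i)) - S i (k' i (x i))))
  have g4 := mul_le_mul_of_nonneg_right hh1
    (norm_nonneg (π i a (S i (k' i (x i))) - S i (S i (k' i (x i)))))
  linarith

end Family

/-! ### Irreducibility and Kadison transitivity -/

/-- A representation is irreducible if its commutant is trivial. -/
def IsIrreducible {A H : Type*} [CStarAlgebra A]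
    [NormedAddCommGroup H] [InnerProductSpace ℂ H] [CompleteSpace H]
    (π : A →⋆ₐ[ℂ] (H →L[ℂ] H)) : Prop :=
  ∀ V : H →L[ℂ] H, Intertwines π π V → ∃ c : ℂ, ∀ x, V x = c • x

section Irreducible

variable {A H : Type*} [CStarAlgebra A]
    [NormedAddCommGroup H] [InnerProductSpace ℂ H] [CompleteSpace H]
    {π : A →⋆ₐ[ℂ] (H →L[ℂ] H)}

/-- Near zero `2t/(1 + t²)` is `2t` up to a cubic error. With `R = S/8`, the operator `4f` differs
from `S` by `4R²f`, of norm at most `1/16`; approximating `f` to within `1/64` costs another `1/16`.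
-/
theorem IsIrreducible.exists_approx (hπ : IsIrreducible π) {S : H →L[ℂ] H}
    (hsa : IsSelfAdjoint S) (hS : ‖S‖ ≤ 1) {ι : Type*} [Fintype ι] (x : ι → H) :
    ∃ h : A, IsSelfAdjoint h ∧ ‖h‖ ≤ 8 ∧ ∀ i, ‖x i‖ ≤ 1 → ‖π h (x i) - S (x i)‖ ≤ 1 / 8 := by
  let R : H →L[ℂ] H := (8⁻¹ : ℝ) • S
  have hR : IsSelfAdjoint R := IsSelfAdjoint.smul (IsSelfAdjoint.all _) hsa
  have hRn : ‖R‖ ≤ 8⁻¹ := by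
    rw [norm_smul, Real.norm_of_nonneg (by norm_num)]
    linarith
  obtain ⟨k, f, -, hk1, hf1, -, hk, -, hf⟩ := exists_resolvent R hR
  obtain ⟨h, hh, hh1, hhx⟩ := exists_isSelfAdjoint_norm_le_one_approx (ι := ι) (H := fun _ => H)
    (fun _ => π) (fun _ => R) (fun _ => k) (fun _ => f)
    (fun _ v w => by
      rw [← ContinuousLinearMap.adjoint_inner_right, ← ContinuousLinearMap.star_eq_adjoint, hR])
    (fun _ _ V hV v => by
      obtain ⟨c, hc⟩ := hπ V hV
      rw [hc, hc, map_smul]) (fun _ => hk) (fun _ => hf) x (show (0 : ℝ) < 1 / 64 by norm_num)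
  refine ⟨(4 : ℝ) • h, IsSelfAdjoint.smul (IsSelfAdjoint.all _) hh, ?_, fun i hi => ?_⟩
  · rw [norm_smul, Real.norm_of_nonneg (by norm_num)]
    linarith
  · have e1 : f = 2 * R - R * R * f := by
      have : (1 + R * R) * f = 2 * R := by
        rw [hf]
        calc (1 + R * R) * (2 * (R * k)) = 2 * R * ((1 + R * R) * k) := by noncomm_ring
          _ = 2 * R := by rw [hk, mul_one]
      rw [← this]; noncomm_ring
    have e2 : (4 : ℝ) • f (x i) - S (x i) = -((4 : ℝ) • (R * R * f) (x i)) := by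
      have e3 := congrArg (fun T : H →L[ℂ] H => (4 : ℝ) • T (x i)) e1
      have e4 : S (x i) = (4 : ℝ) • (2 * R) (x i) := by
        rw [two_mul]
        simp only [R, add_apply, smul_apply]
        module
      simp only [sub_apply, smul_sub] at e3
      rw [e3, ← e4]
      abel
    have e5 : ‖(R * R * f) (x i)‖ ≤ 8⁻¹ * 8⁻¹ := by
      refine ((R * R * f).le_opNorm _).trans ?_
      have : ‖R * R * f‖ ≤ 8⁻¹ * 8⁻¹ * 1 := by
        refine (norm_mul_le _ _).trans ?_
        refine mul_le_mul ((norm_mul_le _ _).trans ?_) hf1 (norm_nonneg _) (by norm_num)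
        exact mul_le_mul hRn hRn (norm_nonneg _) (by norm_num)
      nlinarith [norm_nonneg (R * R * f), norm_nonneg (x i)]
    have e6 : π ((4 : ℝ) • h) (x i) = (4 : ℝ) • π h (x i) := by
      rw [← Complex.coe_smul, map_smul, smul_apply, Complex.coe_smul]
    have e7 : π ((4 : ℝ) • h) (x i) - S (x i) =
        (4 : ℝ) • (π h (x i) - f (x i)) + ((4 : ℝ) • f (x i) - S (x i)) := by
      rw [e6]; module
    rw [e7, e2]
    refine (norm_add_le _ _).trans ?_
    rw [norm_neg, norm_smul, norm_smul, Real.norm_of_nonneg (by norm_num)]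
    have := hhx i
    linarith

end Irreducible

section Rep

variable {A H : Type*} [CStarAlgebra A]
    [NormedAddCommGroup H] [InnerProductSpace ℂ H] [CompleteSpace H]
    {π : A →⋆ₐ[ℂ] (H →L[ℂ] H)}

theorem continuous_rep_apply (π : A →⋆ₐ[ℂ] (H →L[ℂ] H)) (v : H) : Continuous fun a => π a v :=
  (AddMonoidHomClass.continuous_of_bound π 1 fun a => by
    simpa using NonUnitalStarAlgHom.norm_apply_le π a).clm_apply continuous_const

theorem rep_exp_apply {a : A} {v : H} {c : ℂ} (h : π a v = c • v) :
    π (NormedSpace.exp a) v = Complex.exp c • v := by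
  have hpow : ∀ n : ℕ, π (a ^ n) v = c ^ n • v := by
    intro n
    induction n with
    | zero => simp
    | succ n ih =>
      rw [pow_succ, map_mul, mul_apply_eq_comp, h, map_smul, ih, smul_smul, pow_succ']
  let L : A →ₗ[ℂ] H :=
    { toFun := fun a => π a v, map_add' := fun a b => by simp, map_smul' := fun c a => by simp }
  have h1 : HasSum (fun n : ℕ => L ((n.factorial⁻¹ : ℂ) • a ^ n)) (L (NormedSpace.exp a)) :=
    (NormedSpace.exp_series_hasSum_exp' (𝕂 := ℂ) a).map L (continuous_rep_apply π v)
  have h2 : HasSum (fun n : ℕ => ((n.factorial⁻¹ : ℂ) • c ^ n) • v) (NormedSpace.exp c • v) :=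
    (NormedSpace.exp_series_hasSum_exp' (𝕂 := ℂ) c).smul_const v
  rw [Complex.exp_eq_exp_ℂ]
  refine h1.unique ?_
  convert h2 using 2 with n
  change π _ v = _
  rw [map_smul, smul_apply, hpow, smul_smul, smul_eq_mul]

omit [CompleteSpace H] in
-- Coordinates in an orthonormal pair are bounded by the norm, so smallness of `D` on two vectors
-- becomes an operator norm bound on their span.
theorem norm_comp_pair_le {z w : H} (hz : ‖z‖ = 1) (hw : ‖w‖ = 1) (hzw : ⟪z, w⟫_ℂ = 0)
    {P : H →L[ℂ] H} (hP : ∀ v, P v ∈ Submodule.span ℂ {z, w}) (hP1 : ‖P‖ ≤ 1)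
    {D : H →L[ℂ] H} {r : ℝ} (hDz : ‖D z‖ ≤ r) (hDw : ‖D w‖ ≤ r) : ‖D * P‖ ≤ 2 * r := by
  have hr : 0 ≤ r := (norm_nonneg _).trans hDz
  refine ContinuousLinearMap.opNorm_le_bound _ (by positivity) fun v => ?_
  obtain ⟨a, b, hab⟩ := Submodule.mem_span_pair.1 (hP v)
  have hPv : ‖P v‖ ≤ ‖v‖ := (P.le_opNorm v).trans (by nlinarith [norm_nonneg v])
  have ha : ‖a‖ ≤ ‖v‖ := by
    have : ⟪z, P v⟫_ℂ = a := by
      rw [← hab, inner_add_right, inner_smul_right, inner_smul_right, hzw,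
        inner_self_eq_norm_sq_to_K, hz]
      simp
    rw [← this]
    refine (norm_inner_le_norm _ _).trans ?_
    rw [hz, one_mul]; exact hPv
  have hb : ‖b‖ ≤ ‖v‖ := by
    have : ⟪w, P v⟫_ℂ = b := by
      rw [← hab, inner_add_right, inner_smul_right, inner_smul_right, inner_eq_zero_symm.1 hzw,
        inner_self_eq_norm_sq_to_K, hw]
      simp
    rw [← this]
    refine (norm_inner_le_norm _ _).trans ?_
    rw [hw, one_mul]; exact hPv
  rw [mul_apply_eq_comp, ← hab, map_add, map_smul, map_smul]
  refine (norm_add_le _ _).trans ?_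
  rw [norm_smul, norm_smul]
  have h1 := mul_le_mul ha hDz (norm_nonneg _) (norm_nonneg _)
  have h2 := mul_le_mul hb hDw (norm_nonneg _) (norm_nonneg _)
  linarith

theorem IsIrreducible.exists_approx_pair (hπ : IsIrreducible π) {z w : H} (hz : ‖z‖ = 1)
    (hw : ‖w‖ = 1) (hzw : ⟪z, w⟫_ℂ = 0) {D : H →L[ℂ] H} (hD : IsSelfAdjoint D) {r : ℝ}
    (hr : 0 < r) (hDz : ‖D z‖ ≤ r) (hDw : ‖D w‖ ≤ r) :
    ∃ h : A, IsSelfAdjoint h ∧ ‖h‖ ≤ 48 * r ∧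
      ‖π h z - D z‖ ≤ 3 / 4 * r ∧ ‖π h w - D w‖ ≤ 3 / 4 * r := by
  have : FiniteDimensional ℂ (Submodule.span ℂ ({z, w} : Set H)) :=
    FiniteDimensional.span_of_finite ℂ (Set.toFinite _)
  set P := (Submodule.span ℂ {z, w}).starProjection with hP
  have hP1 : ‖P‖ ≤ 1 := Submodule.starProjection_norm_le _
  have hPsa : IsSelfAdjoint P := isSelfAdjoint_starProjection _
  have hPz : P z = z := Submodule.starProjection_eq_self_iff.2 (Submodule.subset_span (by simp))
  have hPw : P w = w := Submodule.starProjection_eq_self_iff.2 (Submodule.subset_span (by simp))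
  -- `D` itself need not be small in norm. `R` is a self-adjoint operator agreeing with `D` on `z`
  -- and `w`, with norm at most `6r`; rescaling by `6r` gives the constants `48r` and `3r/4`.
  let R := D * P + P * D - P * (D * P)
  have hR : IsSelfAdjoint R := by
    simp only [R, IsSelfAdjoint, star_sub, star_add, star_mul, hD.star_eq, hPsa.star_eq]
    noncomm_ring
  have hDP : ‖D * P‖ ≤ 2 * r := norm_comp_pair_le hz hw hzw
    (fun v => Submodule.starProjection_apply_mem _ v) hP1 hDz hDw
  have hPD : ‖P * D‖ ≤ 2 * r := by
    rw [← norm_star, star_mul, hD.star_eq, hPsa.star_eq]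
    exact hDP
  have hPDP : ‖P * (D * P)‖ ≤ 2 * r := by
    refine (norm_mul_le _ _).trans ?_
    nlinarith [norm_nonneg (D * P)]
  have hRn : ‖R‖ ≤ 6 * r := by
    refine (norm_sub_le _ _).trans ?_
    have := norm_add_le (D * P) (P * D)
    linarith
  have hRz : R z = D z := by simp [R, hPz]
  have hRw : R w = D w := by simp [R, hPw]
  have hr6 : 0 < 6 * r := by positivity
  obtain ⟨h, hh, hh8, hx⟩ := hπ.exists_approx (S := (6 * r)⁻¹ • R)
    (IsSelfAdjoint.smul (IsSelfAdjoint.all _) hR)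
    (by rw [norm_smul, norm_inv, Real.norm_of_nonneg hr6.le, inv_mul_le_iff₀ hr6]; linarith)
    (fun b : Bool => bif b then z else w)
  have key : ∀ v, ‖π h v - ((6 * r)⁻¹ • R) v‖ ≤ 1 / 8 →
      ‖π ((6 * r) • h) v - R v‖ ≤ 3 / 4 * r := by
    intro v hv
    have : π ((6 * r) • h) v - R v = (6 * r) • (π h v - ((6 * r)⁻¹ • R) v) := by
      rw [smul_sub, smul_apply, smul_inv_smul₀ hr6.ne', ← Complex.coe_smul, map_smul, smul_apply,
        Complex.coe_smul]
    rw [this, norm_smul, Real.norm_of_nonneg hr6.le]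
    nlinarith
  refine ⟨(6 * r) • h, IsSelfAdjoint.smul (IsSelfAdjoint.all _) hh, ?_, ?_, ?_⟩
  · rw [norm_smul, Real.norm_of_nonneg hr6.le]
    nlinarith
  · rw [← hRz]; exact key z (hx true hz.le)
  · rw [← hRw]; exact key w (hx false hw.le)

/-- Kadison transitivity for self-adjoint operators and two orthonormal vectors. -/
theorem IsIrreducible.exists_eq_pair (hπ : IsIrreducible π) {z w : H} (hz : ‖z‖ = 1)
    (hw : ‖w‖ = 1) (hzw : ⟪z, w⟫_ℂ = 0) {T : H →L[ℂ] H} (hT : IsSelfAdjoint T) :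
    ∃ h : A, IsSelfAdjoint h ∧ π h z = T z ∧ π h w = T w := by
  set r : ℝ := ‖T z‖ + ‖T w‖ + 1 with hr
  have hr0 : 0 < r := by positivity
  -- Successive approximation: each correction reduces the error on `z` and `w` by the factor `3/4`,
  -- and its norm is geometrically small, so the partial sums converge in the algebra.
  let p : ℕ → A → Prop := fun n s => IsSelfAdjoint s ∧
    ‖(T - π s) z‖ ≤ (3 / 4) ^ n * r ∧ ‖(T - π s) w‖ ≤ (3 / 4) ^ n * r
  have step : ∀ n (s : A), p n s → ∃ s', p (n + 1) s' ∧ dist s s' ≤ 48 * r * (3 / 4) ^ n := by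
    rintro n s ⟨hs, h1, h2⟩
    obtain ⟨h, hh, hn, hz', hw'⟩ := hπ.exists_approx_pair hz hw hzw
      (hT.sub (hs.map π)) (r := (3 / 4) ^ n * r) (by positivity) h1 h2
    have e : ∀ v, (T - π (s + h)) v = -(π h v - (T - π s) v) := fun v => by
      simp only [map_add, sub_apply, add_apply]; abel
    refine ⟨s + h, ⟨hs.add hh, ?_, ?_⟩, ?_⟩
    · rw [e, norm_neg, pow_succ]; linarith
    · rw [e, norm_neg, pow_succ]; linarith
    · rw [dist_self_add_right]; linarith
  have p0 : p 0 0 := by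
    refine ⟨IsSelfAdjoint.zero A, ?_, ?_⟩ <;>
    · simp only [map_zero, sub_zero, pow_zero, one_mul, hr]
      linarith [norm_nonneg (T z), norm_nonneg (T w)]
  let u : ∀ n, {s // p n s} := fun n => Nat.rec ⟨0, p0⟩
    (fun n s => ⟨(step n s.1 s.2).choose, (step n s.1 s.2).choose_spec.1⟩) n
  have hu : ∀ n, dist (u n).1 (u (n + 1)).1 ≤ 48 * r * (3 / 4) ^ n := fun n =>
    (step n (u n).1 (u n).2).choose_spec.2
  obtain ⟨h, hlim⟩ := cauchySeq_tendsto_of_complete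
    (cauchySeq_of_le_geometric (3 / 4 : ℝ) (48 * r) (by norm_num) hu)
  have hpow : Filter.Tendsto (fun n : ℕ => (3 / 4 : ℝ) ^ n * r) Filter.atTop (nhds 0) := by
    simpa using (tendsto_pow_atTop_nhds_zero_of_lt_one (r := (3 / 4 : ℝ)) (by norm_num)
      (by norm_num)).mul_const r
  have lim : ∀ v, (∀ n, ‖(T - π (u n).1) v‖ ≤ (3 / 4) ^ n * r) → π h v = T v := by
    intro v hv
    have h1 : Filter.Tendsto (fun n => T v - π (u n).1 v) Filter.atTop (nhds 0) :=
      squeeze_zero_norm hv hpow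
    have h2 := (((continuous_rep_apply π v).tendsto h).comp hlim).const_sub (T v)
    exact (sub_eq_zero.1 (tendsto_nhds_unique h2 h1)).symm
  refine ⟨h, ?_, lim z fun n => (u n).2.2.1, lim w fun n => (u n).2.2.2⟩
  exact (isClosed_eq continuous_star continuous_id).mem_of_tendsto hlim
    (Filter.Eventually.of_forall fun n => (u n).2.1)

theorem exists_phase (s : ℂ) : ∃ c : ℂ, ‖c‖ = 1 ∧ c * s = (‖s‖ : ℂ) := by
  rcases eq_or_ne s 0 with h | h
  · exact ⟨1, by simp, by simp [h]⟩
  · refine ⟨(‖s‖ : ℂ) / s, ?_, by field_simp⟩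
    rw [norm_div, Complex.norm_real, norm_norm, div_self (norm_ne_zero_iff.2 h)]

/-- Kadison transitivity: a unitary of the algebra moves any unit vector to any other one,
up to a phase. -/
theorem IsIrreducible.exists_unitary (hπ : IsIrreducible π) {x y : H} (hx : ‖x‖ = 1)
    (hy : ‖y‖ = 1) : ∃ U ∈ unitary A, ∃ c : ℂ, ‖c‖ = 1 ∧ π U x = c • y := by
  -- Once the phase makes the inner product real and nonnegative, `x - y'` and `x + y'` are
  -- orthogonal and the latter is nonzero.
  obtain ⟨c, hc, hcr⟩ := exists_phase (⟪x, y⟫_ℂ)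
  set y' := c • y with hy'
  have hy'n : ‖y'‖ = 1 := by rw [hy', norm_smul, hc, hy, one_mul]
  have hxy : ⟪x, y'⟫_ℂ = (‖⟪x, y⟫_ℂ‖ : ℂ) := by rw [hy', inner_smul_right, hcr]
  have hyx : ⟪y', x⟫_ℂ = (‖⟪x, y⟫_ℂ‖ : ℂ) := by
    rw [← inner_conj_symm, hxy, Complex.conj_ofReal]
  by_cases hd : x = y'
  · exact ⟨1, one_mem _, c, hc, by simpa using hd⟩
  have hd0 : x - y' ≠ 0 := sub_ne_zero.2 hd
  have hs0 : x + y' ≠ 0 := by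
    intro h0
    have h1 : ⟪x, x + y'⟫_ℂ = 0 := by rw [h0, inner_zero_right]
    rw [inner_add_right, hxy, inner_self_eq_norm_sq_to_K, hx] at h1
    have h2 := congrArg Complex.re h1
    simp at h2
    linarith [norm_nonneg (⟪x, y⟫_ℂ)]
  have horth : ⟪x - y', x + y'⟫_ℂ = 0 := by
    rw [inner_sub_left, inner_add_right, inner_add_right, hxy, hyx, inner_self_eq_norm_sq_to_K,
      inner_self_eq_norm_sq_to_K, hx, hy'n]
    ring
  have hnd : (‖x - y'‖ : ℂ) ≠ 0 := by simpa using hd0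
  have hns : (‖x + y'‖ : ℂ) ≠ 0 := by simpa using hs0
  set z := (‖x - y'‖ : ℂ)⁻¹ • (x - y') with hz
  set w := (‖x + y'‖ : ℂ)⁻¹ • (x + y') with hw
  have hzn : ‖z‖ = 1 := norm_smul_inv_norm hd0
  have hwn : ‖w‖ = 1 := norm_smul_inv_norm hs0
  have hzw : ⟪z, w⟫_ℂ = 0 := by
    rw [hz, hw, inner_smul_left, inner_smul_right, horth, mul_zero, mul_zero]
  -- `π h` has eigenvalue `1` on `x - y'` and `0` on `x + y'`, so the exponential of `iπh` (with the
  -- number π) negates the first and fixes the second, exchanging `x` and `y'`.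
  obtain ⟨h, hh, h1, h2⟩ := hπ.exists_eq_pair hzn hwn hzw
    (T := InnerProductSpace.rankOne ℂ z z) (by
      rw [ContinuousLinearMap.isSelfAdjoint_iff', InnerProductSpace.adjoint_rankOne])
  rw [InnerProductSpace.rankOne_apply, inner_self_eq_norm_sq_to_K, hzn] at h1
  rw [InnerProductSpace.rankOne_apply, hzw, zero_smul] at h2
  have hxd : x - y' = (‖x - y'‖ : ℂ) • z := by rw [hz, smul_inv_smul₀ hnd]
  have hxs : x + y' = (‖x + y'‖ : ℂ) • w := by rw [hw, smul_inv_smul₀ hns]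
  let a : A := (Complex.I * Real.pi) • h
  have hπa : π a = (Complex.I * Real.pi) • π h := map_smul _ _ _
  have haz : π a (x - y') = (Real.pi * Complex.I) • (x - y') := by
    rw [hπa, hxd, map_smul, smul_apply, h1]
    simp only [smul_smul]
    congr 1
    simp; ring
  have haw : π a (x + y') = (0 : ℂ) • (x + y') := by
    rw [hπa, hxs, map_smul, smul_apply, h2]
    simp
  have hz' := rep_exp_apply haz
  have hw' := rep_exp_apply haw
  rw [Complex.exp_pi_mul_I] at hz'
  rw [Complex.exp_zero] at hw'
  refine ⟨selfAdjoint.expUnitary ⟨Real.pi • h, IsSelfAdjoint.smul (IsSelfAdjoint.all _) hh⟩,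
    Subtype.coe_prop _, c, hc, ?_⟩
  have ha : ((selfAdjoint.expUnitary ⟨Real.pi • h, IsSelfAdjoint.smul (IsSelfAdjoint.all _) hh⟩ :
      unitary A) : A) = NormedSpace.exp a := by
    refine congrArg NormedSpace.exp (?_ : Complex.I • Real.pi • h = a)
    rw [← Complex.coe_smul Real.pi h, smul_smul]
  rw [ha]
  have e : (2 : ℂ) • π (NormedSpace.exp a) x = (2 : ℂ) • y' := by
    have : (2 : ℂ) • x = (x - y') + (x + y') := by module
    rw [← map_smul, this, map_add, hz', hw']
    module
  exact smul_right_injective H (two_ne_zero (α := ℂ)) e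

end Rep

universe u

/-! ### Schur's lemma and disjoint representations -/

section Schur

variable {A H K : Type*} [CStarAlgebra A]
    [NormedAddCommGroup H] [InnerProductSpace ℂ H] [CompleteSpace H]
    [NormedAddCommGroup K] [InnerProductSpace ℂ K] [CompleteSpace K]
    {π : A →⋆ₐ[ℂ] (H →L[ℂ] H)} {ρ : A →⋆ₐ[ℂ] (K →L[ℂ] K)}

theorem Intertwines.adjoint {V : H →L[ℂ] K} (hV : Intertwines π ρ V) :
    Intertwines ρ π (ContinuousLinearMap.adjoint V) := by
  intro a y
  refine ext_inner_right ℂ fun x => ?_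
  rw [ContinuousLinearMap.adjoint_inner_left, inner_rep_apply, inner_rep_apply,
    ContinuousLinearMap.adjoint_inner_left, hV]

/-- A nonzero intertwiner realizes vector states of an irreducible representation as vector
states of the other representation. -/
theorem exists_vector_of_intertwiner (hρ : IsIrreducible ρ) {V : H →L[ℂ] K}
    (hV : Intertwines π ρ V) (hV0 : V ≠ 0) {x : K} (hx : ‖x‖ = 1) :
    ∃ y : H, ‖y‖ = 1 ∧ ∀ a, ⟪y, π a y⟫_ℂ = ⟪x, ρ a x⟫_ℂ := by
  set V' := ContinuousLinearMap.adjoint V with hV'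
  -- `V V*` lies in the commutant of `ρ`, hence is a scalar, nonzero as `V ≠ 0`. The required vector
  -- is the normalised `V* x`.
  obtain ⟨d, hd⟩ := hρ (V ∘L V') fun a y => by
    rw [ContinuousLinearMap.comp_apply, ContinuousLinearMap.comp_apply, hV.adjoint, hV]
  have h1 : ∀ a, ⟪V' x, π a (V' x)⟫_ℂ = star d * ⟪x, ρ a x⟫_ℂ := by
    intro a
    rw [← hV.adjoint, ContinuousLinearMap.adjoint_inner_right]
    have := hd x
    rw [ContinuousLinearMap.comp_apply] at this
    rw [this, inner_smul_left]
    rfl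
  have h2 : star d = (‖V' x‖ : ℂ) ^ 2 := by
    have := h1 1
    rw [map_one, map_one, one_apply_eq_self, one_apply_eq_self,
      inner_self_eq_norm_sq_to_K, inner_self_eq_norm_sq_to_K, hx] at this
    simpa using this.symm
  have h3 : V' x ≠ 0 := by
    intro h0
    rw [h0, norm_zero] at h2
    have hd0 : d = 0 := by simpa using h2
    apply hV0
    have h4 : V' = 0 := by
      ext y
      have h5 := hd y
      rw [hd0, zero_smul, ContinuousLinearMap.comp_apply] at h5
      have h6 : ⟪V' y, V' y⟫_ℂ = 0 := by
        nth_rewrite 1 [hV']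
        rw [ContinuousLinearMap.adjoint_inner_left, h5, inner_zero_right]
      simpa using h6
    rw [← ContinuousLinearMap.adjoint_adjoint V, ← hV', h4, map_zero]
  have h4 : (‖V' x‖ : ℂ) ≠ 0 := by simpa using h3
  refine ⟨(‖V' x‖ : ℂ)⁻¹ • V' x, norm_smul_inv_norm h3, fun a => ?_⟩
  rw [map_smul, inner_smul_left, inner_smul_right, h1, h2, map_inv₀, Complex.conj_ofReal]
  field_simp

end Schur

/-- Vector functionals of disjoint irreducible representations are far apart. -/
theorem two_le_norm_sub_of_disjoint {A : Type*} [CStarAlgebra A] {H : Bool → Type*}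
    [∀ b, NormedAddCommGroup (H b)] [∀ b, InnerProductSpace ℂ (H b)] [∀ b, CompleteSpace (H b)]
    (π : ∀ b, A →⋆ₐ[ℂ] (H b →L[ℂ] H b))
    (hdis : ∀ i j (V : H i →L[ℂ] H j), i ≠ j → Intertwines (π i) (π j) V → V = 0)
    (ω : Bool → StrongDual ℂ A) (x : ∀ b, H b) (hx : ∀ b, ‖x b‖ = 1)
    (hω : ∀ b a, ω b a = ⟪x b, π b a (x b)⟫_ℂ) : 2 ≤ ‖ω true - ω false‖ := by
  let s : Bool → ℝ := fun b => bif b then 1 else -1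
  have hs : ∀ b, s b * s b = 1 := by intro b; cases b <;> simp [s]
  refine le_of_forall_pos_lt_add fun ε hε => ?_
  -- The scalars `±1` commute with all intertwiners since none links the two summands. From `S² = 1`
  -- one gets `k' = 1/2` and `2S(1 + S²)⁻¹ = S`.
  obtain ⟨h, -, hh1, hh⟩ := exists_isSelfAdjoint_norm_le_one_approx π
    (fun b => (s b : ℂ) • 1) (fun b => (2⁻¹ : ℂ) • 1) (fun b => (s b : ℂ) • 1)
    (fun b v w => by simp)
    (fun i j V hV v => by
      rcases eq_or_ne i j with rfl | hij
      · simp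
      · simp [hdis i j V hij hV])
    (fun b => by
      have : (s b : ℂ) * s b = 1 := by exact_mod_cast hs b
      rw [smul_mul_smul_comm, this, mul_one, one_smul, mul_smul_comm, mul_one, ← two_smul ℂ,
        smul_smul]
      norm_num)
    (fun b => by
      rw [smul_mul_smul_comm, mul_one, two_mul, ← two_smul ℂ, smul_smul]
      congr 1; ring)
    x (show 0 < ε / 4 by positivity)
  have key : ∀ b, ‖ω b h - s b‖ ≤ ε / 4 := by
    intro b
    have e : ω b h - s b = ⟪x b, π b h (x b) - ((s b : ℂ) • (1 : H b →L[ℂ] H b)) (x b)⟫_ℂ := by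
      rw [inner_sub_right, ← hω, smul_apply, one_apply_eq_self, inner_smul_right,
        inner_self_eq_norm_sq_to_K, hx]
      simp
    rw [e]
    refine (norm_inner_le_norm _ _).trans ?_
    rw [hx, one_mul]
    exact (hh b).le
  have k1 : ‖ω true h - 1‖ ≤ ε / 4 := by simpa [s] using key true
  have k2 : ‖ω false h + 1‖ ≤ ε / 4 := by simpa [s] using key false
  have h1 : ‖(ω true - ω false) h‖ ≤ ‖ω true - ω false‖ := by
    refine ((ω true - ω false).le_opNorm h).trans ?_
    nlinarith [norm_nonneg (ω true - ω false)]
  have h2 : (2 : ℝ) ≤ ‖(ω true - ω false) h‖ + ‖ω true h - 1‖ + ‖ω false h + 1‖ := by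
    have e : (2 : ℂ) = (ω true - ω false) h - (ω true h - 1) + (ω false h + 1) := by
      rw [sub_apply]; ring
    calc (2 : ℝ) = ‖(2 : ℂ)‖ := by simp
      _ ≤ _ := by
        rw [e]
        exact (norm_add_le _ _).trans (add_le_add_left (norm_sub_le _ _) _)
  linarith

/-! ### GNS representations of pure states -/

/-- A cyclic representation whose cyclic vector induces `ω`. -/
structure CyclicRep {A : Type u} [CStarAlgebra A] (ω : StrongDual ℂ A) where
  space : Type u
  [normed : NormedAddCommGroup space]
  [innerProduct : InnerProductSpace ℂ space]
  [complete : CompleteSpace space]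
  rep : A →⋆ₐ[ℂ] (space →L[ℂ] space)
  vec : space
  apply_eq : ∀ a, ω a = ⟪vec, rep a vec⟫_ℂ
  dense : DenseRange fun a => rep a vec

attribute [instance] CyclicRep.normed CyclicRep.innerProduct CyclicRep.complete

theorem nonempty_cyclicRep {A : Type u} [CStarAlgebra A] {ω : StrongDual ℂ A}
    (hω : ω ∈ states A) : Nonempty (CyclicRep ω) := by
  let _ := CStarAlgebra.spectralOrder A
  have _ := CStarAlgebra.spectralOrderedRing A
  let f : A →ₚ[ℂ] ℂ := PositiveLinearMap.mk₀ (ω : A →ₗ[ℂ] ℂ) fun a ha => by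
    obtain ⟨b, rfl⟩ := CStarAlgebra.nonneg_iff_eq_star_mul_self.1 ha
    exact hω.1 b
  have hrep : ∀ a, f.gnsStarAlgHom a (f.toPreGNS 1 : f.GNS) = (f.toPreGNS a : f.GNS) := by
    intro a
    change f.gnsNonUnitalStarAlgHom a (f.toPreGNS 1 : f.GNS) = _
    rw [PositiveLinearMap.gnsNonUnitalStarAlgHom_apply_coe, PositiveLinearMap.leftMulMapPreGNS_apply]
    simp
  refine ⟨{ space := f.GNS, rep := f.gnsStarAlgHom, vec := (f.toPreGNS 1 : f.GNS),
            apply_eq := fun a => ?_, dense := ?_ }⟩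
  · rw [hrep, UniformSpace.Completion.inner_coe, PositiveLinearMap.preGNS_inner_def]
    simp only [PositiveLinearMap.ofPreGNS_toPreGNS, star_one, one_mul]
    rfl
  · simp only [hrep]
    exact UniformSpace.Completion.denseRange_coe.comp f.toPreGNS.surjective.denseRange
      (UniformSpace.Completion.continuous_coe _)

/-- The orbit map of a vector, as a continuous linear map. -/
noncomputable def repApply {A H : Type*} [CStarAlgebra A]
    [NormedAddCommGroup H] [InnerProductSpace ℂ H] [CompleteSpace H]
    (π : A →⋆ₐ[ℂ] (H →L[ℂ] H)) (v : H) : A →L[ℂ] H :=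
  LinearMap.mkContinuous
    { toFun := fun a => π a v, map_add' := fun a b => by simp, map_smul' := fun c a => by simp }
    ‖v‖ fun a => by rw [mul_comm]; exact norm_rep_le π a v

section Pure

variable {A : Type u} [CStarAlgebra A] {ω : StrongDual ℂ A}

theorem CyclicRep.norm_vec (G : CyclicRep ω) (hω : ω ∈ states A) : ‖G.vec‖ = 1 := by
  have h := G.apply_eq 1
  rw [hω.2, map_one, one_apply_eq_self, inner_self_eq_norm_sq_to_K] at h
  have h2 : ((‖G.vec‖ ^ 2 : ℝ) : ℂ) = (1 : ℝ) := by push_cast; exact h.symm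
  exact (pow_eq_one_iff_of_nonneg (norm_nonneg _) two_ne_zero).1 (Complex.ofReal_injective h2)

/-- A small self-adjoint operator in the commutant perturbs half of `ω` to a multiple of a
state. -/
theorem CyclicRep.perturb_mem_states (G : CyclicRep ω) (hω : ω ∈ states A)
    {B : G.space →L[ℂ] G.space} (hB : ∀ v w, ⟪B v, w⟫_ℂ = ⟪v, B w⟫_ℂ)
    (hBi : Intertwines G.rep G.rep B) (hB1 : ‖B‖ ≤ 1 / 4) {t : ℝ}
    (ht : t = 1 / 2 + (⟪G.vec, B G.vec⟫_ℂ).re) :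
    0 < t ∧ t⁻¹ • ((innerSL ℂ G.vec) ∘L repApply G.rep ((2⁻¹ : ℂ) • G.vec + B G.vec)) ∈
      states A := by
  have hreal : ∀ v, ⟪v, B v⟫_ℂ = ((⟪v, B v⟫_ℂ).re : ℂ) := fun v => by
    refine (Complex.conj_eq_iff_re.1 ?_).symm
    rw [inner_conj_symm, hB]
  have hbd : ∀ v, -(1 / 4 * ‖v‖ ^ 2) ≤ (⟪v, B v⟫_ℂ).re := fun v => by
    have h1 : ‖⟪v, B v⟫_ℂ‖ ≤ 1 / 4 * ‖v‖ ^ 2 := by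
      refine (norm_inner_le_norm _ _).trans ?_
      have := (B.le_opNorm v).trans (mul_le_mul_of_nonneg_right hB1 (norm_nonneg v))
      nlinarith [norm_nonneg v]
    have h2 := (abs_le.1 ((Complex.abs_re_le_norm _).trans h1)).1
    exact h2
  have ht0 : 0 < t := by
    have := hbd G.vec
    rw [G.norm_vec hω] at this
    rw [ht]; linarith
  have happ : ∀ a, ((innerSL ℂ G.vec) ∘L repApply G.rep ((2⁻¹ : ℂ) • G.vec + B G.vec)) a =
      ⟪G.vec, G.rep a ((2⁻¹ : ℂ) • G.vec + B G.vec)⟫_ℂ := fun a => rfl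
  refine ⟨ht0, fun a => ?_, ?_⟩
  · rw [smul_apply, happ, map_mul, mul_apply_eq_comp, ← inner_rep_apply, map_add, map_smul,
      ← hBi, inner_add_right, inner_smul_right, inner_self_eq_norm_sq_to_K, hreal]
    -- Up to the factor `t⁻¹`, the value at `star a * a` is `‖y‖²/2 + Re ⟪y, B y⟫`, which is
    -- nonnegative because `‖B‖ ≤ 1/4`.
    set y := G.rep a G.vec
    have h1 : (2⁻¹ : ℂ) * (‖y‖ : ℂ) ^ 2 + ((⟪y, B y⟫_ℂ).re : ℂ) =
        ((2⁻¹ * ‖y‖ ^ 2 + (⟪y, B y⟫_ℂ).re : ℝ) : ℂ) := by push_cast; ring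
    refine smul_nonneg (inv_nonneg.2 ht0.le) (h1 ▸ Complex.zero_le_real.2 ?_)
    nlinarith [hbd y, sq_nonneg ‖y‖]
  · rw [smul_apply, happ, map_one, one_apply_eq_self, inner_add_right, inner_smul_right,
      inner_self_eq_norm_sq_to_K, hreal, G.norm_vec hω]
    have h1 : (2⁻¹ : ℂ) * ((1 : ℝ) : ℂ) ^ 2 + ((⟪G.vec, B G.vec⟫_ℂ).re : ℂ) = (t : ℂ) := by
      rw [ht]; push_cast; ring
    refine (congrArg (t⁻¹ • ·) h1).trans ?_
    rw [Complex.real_smul, Complex.ofReal_inv, inv_mul_cancel₀ (by exact_mod_cast ht0.ne')]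

/-- Perturbing by `B` and by `-B` writes `ω` as a proper convex combination of two states.
Extremality identifies one of them with `ω`, and cyclicity turns this into `B = r`. -/
theorem CyclicRep.exists_smul_of_small (G : CyclicRep ω) (hω : ω ∈ pureStates A)
    {B : G.space →L[ℂ] G.space} (hB : ∀ v w, ⟪B v, w⟫_ℂ = ⟪v, B w⟫_ℂ)
    (hBi : Intertwines G.rep G.rep B) (hB1 : ‖B‖ ≤ 1 / 4) : ∃ c : ℂ, ∀ x, B x = c • x := by
  set r := (⟪G.vec, B G.vec⟫_ℂ).re with hr
  obtain ⟨ht, h1⟩ := G.perturb_mem_states hω.1 hB hBi hB1 (t := 1 / 2 + r) rfl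
  obtain ⟨ht', h2⟩ := G.perturb_mem_states hω.1 (B := -B) (fun v w => by simp [hB])
    (fun a v => by simp [hBi a v]) (by rwa [norm_neg]) (t := 1 / 2 - r) (by simp [hr]; ring)
  set σ := (1 / 2 + r)⁻¹ •
    ((innerSL ℂ G.vec) ∘L repApply G.rep ((2⁻¹ : ℂ) • G.vec + B G.vec)) with hσ
  set τ := (1 / 2 - r)⁻¹ •
    ((innerSL ℂ G.vec) ∘L repApply G.rep ((2⁻¹ : ℂ) • G.vec + (-B) G.vec)) with hτ
  have hmem : ω ∈ openSegment ℝ σ τ := by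
    refine ⟨1 / 2 + r, 1 / 2 - r, ht, ht', by ring, ?_⟩
    rw [hσ, hτ, smul_inv_smul₀ ht.ne', smul_inv_smul₀ ht'.ne']
    ext a
    change ⟪G.vec, G.rep a ((2⁻¹ : ℂ) • G.vec + B G.vec)⟫_ℂ +
      ⟪G.vec, G.rep a ((2⁻¹ : ℂ) • G.vec + -(B G.vec))⟫_ℂ = ω a
    rw [← inner_add_right, ← map_add, G.apply_eq]
    congr 2
    module
  have hσω : σ = ω := hω.2 h1 h2 hmem
  have happ : ∀ a, ⟪G.vec, G.rep a (B G.vec)⟫_ℂ = (r : ℂ) * ⟪G.vec, G.rep a G.vec⟫_ℂ := by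
    intro a
    have h3 : (1 / 2 + r) • σ = (1 / 2 + r) • ω := by rw [hσω]
    rw [hσ, smul_inv_smul₀ ht.ne'] at h3
    have h4 : ⟪G.vec, G.rep a ((2⁻¹ : ℂ) • G.vec + B G.vec)⟫_ℂ = ((1 / 2 + r : ℝ) : ℂ) * ω a := by
      have := congrArg (fun f : StrongDual ℂ A => f a) h3
      rw [← Complex.real_smul]
      exact this
    rw [map_add, map_smul, inner_add_right, inner_smul_right, G.apply_eq] at h4
    push_cast at h4
    linear_combination h4
  refine ⟨r, fun x => ?_⟩
  have h5 : ∀ a, B (G.rep a G.vec) = (r : ℂ) • G.rep a G.vec := by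
    intro a
    refine G.dense.eq_of_inner_right ℂ fun b => ?_
    change ⟪G.rep b G.vec, B (G.rep a G.vec)⟫_ℂ = ⟪G.rep b G.vec, (r : ℂ) • G.rep a G.vec⟫_ℂ
    rw [hBi, inner_rep_apply, ← mul_apply_eq_comp, ← map_mul, happ, inner_smul_right,
      inner_rep_apply, ← mul_apply_eq_comp, ← map_mul]
  exact congrFun (G.dense.equalizer B.continuous (continuous_const_smul (r : ℂ)) (funext h5)) x

/-- The commutant is closed under adjoints, so it suffices to treat real and imaginary parts,
rescaled to norm at most `1/4`. -/
theorem CyclicRep.isIrreducible (G : CyclicRep ω) (hω : ω ∈ pureStates A) :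
    IsIrreducible G.rep := by
  have sa : ∀ W : G.space →L[ℂ] G.space, (∀ v w, ⟪W v, w⟫_ℂ = ⟪v, W w⟫_ℂ) →
      Intertwines G.rep G.rep W → ∃ c : ℂ, ∀ x, W x = c • x := by
    intro W hW hWi
    set s : ℝ := 4 * (‖W‖ + 1) with hs
    have hs0 : 0 < s := by positivity
    have hsC : (s : ℂ) ≠ 0 := by exact_mod_cast hs0.ne'
    obtain ⟨c, hc⟩ := G.exists_smul_of_small hω (B := (s : ℂ)⁻¹ • W)
      (fun v w => by
        simp only [smul_apply, inner_smul_left, inner_smul_right, map_inv₀, Complex.conj_ofReal, hW])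
      (fun a v => by simp only [smul_apply, hWi a v, map_smul])
      (by
        rw [norm_smul, norm_inv, Complex.norm_real, Real.norm_of_nonneg hs0.le,
          inv_mul_le_iff₀ hs0]
        linarith)
    refine ⟨s * c, fun x => ?_⟩
    rw [mul_smul, ← hc, smul_apply, smul_inv_smul₀ hsC]
  intro V hV
  set V' := ContinuousLinearMap.adjoint V with hV'
  have a1 : ∀ v w, ⟪V v, w⟫_ℂ = ⟪v, V' w⟫_ℂ := fun v w =>
    (ContinuousLinearMap.adjoint_inner_right V v w).symm
  have a2 : ∀ v w, ⟪V' v, w⟫_ℂ = ⟪v, V w⟫_ℂ := fun v w =>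
    ContinuousLinearMap.adjoint_inner_left V w v
  have hV'i : Intertwines G.rep G.rep V' := hV.adjoint
  obtain ⟨c, hc⟩ := sa (V + V')
    (fun v w => by
      simp only [add_apply, inner_add_left, inner_add_right, a1, a2]; ring)
    (fun a v => by simp only [add_apply, hV a v, hV'i a v, map_add])
  obtain ⟨d, hd⟩ := sa (Complex.I • (V - V'))
    (fun v w => by
      simp only [smul_apply, sub_apply, inner_smul_left, inner_smul_right, inner_sub_left,
        inner_sub_right, a1, a2, Complex.conj_I]
      ring)
    (fun a v => by simp only [smul_apply, sub_apply, hV a v, hV'i a v, map_sub, map_smul])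
  refine ⟨2⁻¹ * (c - Complex.I * d), fun x => ?_⟩
  have e1 := hc x
  have e2 := hd x
  have e3 : V x = (2⁻¹ : ℂ) • ((V + V') x - Complex.I • (Complex.I • (V - V')) x) := by
    simp only [smul_apply, sub_apply, add_apply, smul_smul, Complex.I_mul_I]
    module
  rw [e3, e1, e2]
  module

end Pure

/-! ### Unitary conjugation and distance of vector states -/

section Conj

variable {A : Type*} [CStarAlgebra A]

/-- The functional `a ↦ ω (U⋆ a U)`. -/
noncomputable def conjFunctional (U : A) (ω : StrongDual ℂ A) : StrongDual ℂ A :=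
  ω ∘L (ContinuousLinearMap.mul ℂ A (star U)) ∘L ((ContinuousLinearMap.mul ℂ A).flip U)

theorem conjFunctional_apply (U : A) (ω : StrongDual ℂ A) (a : A) :
    conjFunctional U ω a = ω (star U * a * U) := by
  rw [mul_assoc]; rfl

theorem conjFunctional_mem_states {U : A} (hU : U ∈ unitary A) {ω : StrongDual ℂ A}
    (hω : ω ∈ states A) : conjFunctional U ω ∈ states A := by
  refine ⟨fun a => ?_, ?_⟩
  · have h := hω.1 (a * U)
    rw [conjFunctional_apply]
    rwa [star_mul, mul_assoc, ← mul_assoc (star a), ← mul_assoc] at h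
  · rw [conjFunctional_apply, mul_one, Unitary.star_mul_self_of_mem hU, hω.2]

theorem conjFunctional_star_conjFunctional {U : A} (hU : U ∈ unitary A) (ω : StrongDual ℂ A) :
    conjFunctional (star U) (conjFunctional U ω) = ω := by
  ext a
  rw [conjFunctional_apply, conjFunctional_apply, star_star]
  congr 1
  calc star U * (U * a * star U) * U = (star U * U) * a * (star U * U) := by noncomm_ring
    _ = a := by rw [Unitary.star_mul_self_of_mem hU, one_mul, mul_one]

/-- Conjugation is an affine bijection of the state space, with inverse conjugation by `star U`, so
it preserves extreme points. -/
theorem conjFunctional_mem_pureStates {U : A} (hU : U ∈ unitary A) {ω : StrongDual ℂ A}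
    (hω : ω ∈ pureStates A) : conjFunctional U ω ∈ pureStates A := by
  refine ⟨conjFunctional_mem_states hU hω.1, fun σ hσ τ hτ h => ?_⟩
  have hU' : star U ∈ unitary A := Unitary.star_mem hU
  obtain ⟨s, t, hs, ht, hst, h⟩ := h
  have h1 : conjFunctional (star U) σ = ω := by
    refine hω.2 (conjFunctional_mem_states hU' hσ) (conjFunctional_mem_states hU' hτ)
      ⟨s, t, hs, ht, hst, ?_⟩
    rw [← conjFunctional_star_conjFunctional hU ω, ← h]
    rfl
  rw [← h1]
  have := conjFunctional_star_conjFunctional hU' σ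
  rw [star_star] at this
  exact this.symm

theorem UnitarilyEquivalent.symm {ω₀ ω₁ : pureStates A} (h : UnitarilyEquivalent ω₀ ω₁) :
    UnitarilyEquivalent ω₁ ω₀ := by
  obtain ⟨U, hU, h⟩ := h
  refine ⟨star U, Unitary.star_mem hU, fun a => ?_⟩
  rw [← h]
  congr 1
  rw [star_star]
  calc star U * (U * a * star U) * U = (star U * U) * a * (star U * U) := by noncomm_ring
    _ = a := by rw [Unitary.star_mul_self_of_mem hU, one_mul, mul_one]

theorem UnitarilyEquivalent.trans {ω₀ ω₁ ω₂ : pureStates A} (h : UnitarilyEquivalent ω₀ ω₁)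
    (h' : UnitarilyEquivalent ω₁ ω₂) : UnitarilyEquivalent ω₀ ω₂ := by
  obtain ⟨U, hU, h⟩ := h
  obtain ⟨W, hW, h'⟩ := h'
  refine ⟨U * W, mul_mem hU hW, fun a => ?_⟩
  rw [← h, ← h']
  congr 1
  rw [star_mul]
  noncomm_ring

theorem UnitarilyEquivalent.refl (ω : pureStates A) : UnitarilyEquivalent ω ω :=
  ⟨1, one_mem _, fun a => by simp⟩

end Conj

/-- After a phase change making `⟪x, y'⟫ = r > 0`, polarisation bounds the distance by `‖x - y'‖ ‖x
+ y'‖ = 2√(1 - r²)`. -/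
theorem norm_sub_lt_two_of_inner_ne_zero {A H : Type*} [CStarAlgebra A]
    [NormedAddCommGroup H] [InnerProductSpace ℂ H] [CompleteSpace H]
    (π : A →⋆ₐ[ℂ] (H →L[ℂ] H)) {x y : H} (hx : ‖x‖ = 1) (hy : ‖y‖ = 1) (hxy : ⟪x, y⟫_ℂ ≠ 0)
    {f g : StrongDual ℂ A} (hf : ∀ a, f a = ⟪x, π a x⟫_ℂ) (hg : ∀ a, g a = ⟪y, π a y⟫_ℂ) :
    ‖f - g‖ < 2 := by
  obtain ⟨c, hc, hcr⟩ := exists_phase (⟪x, y⟫_ℂ)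
  set r := ‖⟪x, y⟫_ℂ‖ with hr
  have hr0 : 0 < r := norm_pos_iff.2 hxy
  set y' := c • y with hy'
  have hy'n : ‖y'‖ = 1 := by rw [hy', norm_smul, hc, hy, one_mul]
  have hxy' : (⟪x, y'⟫_ℂ).re = r := by rw [hy', inner_smul_right, hcr, Complex.ofReal_re]
  have hg' : ∀ a, g a = ⟪y', π a y'⟫_ℂ := fun a => by
    have hcc : (starRingEnd ℂ) c * c = 1 := by
      rw [mul_comm, Complex.mul_conj, Complex.normSq_eq_norm_sq, hc]; simp
    rw [hg, hy', map_smul, inner_smul_left, inner_smul_right, ← mul_assoc, hcc, one_mul]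
  have hsub : ‖x - y'‖ ^ 2 = 2 - 2 * r := by
    rw [norm_sub_sq (𝕜 := ℂ), hx, hy'n]
    change 1 ^ 2 - 2 * (⟪x, y'⟫_ℂ).re + 1 ^ 2 = _
    rw [hxy']; ring
  have hadd : ‖x + y'‖ ^ 2 = 2 + 2 * r := by
    rw [norm_add_sq (𝕜 := ℂ), hx, hy'n]
    change 1 ^ 2 + 2 * (⟪x, y'⟫_ℂ).re + 1 ^ 2 = _
    rw [hxy']; ring
  have hlt : ‖x - y'‖ * ‖x + y'‖ < 2 := by
    refine lt_of_pow_lt_pow_left₀ 2 (by norm_num) ?_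
    rw [mul_pow, hsub, hadd]
    nlinarith
  refine lt_of_le_of_lt (ContinuousLinearMap.opNorm_le_bound _ (by positivity) fun a => ?_) hlt
  have e : (f - g) a = 2⁻¹ * (⟪x - y', π a (x + y')⟫_ℂ + ⟪x + y', π a (x - y')⟫_ℂ) := by
    rw [sub_apply, hf, hg']
    simp only [map_add, map_sub, inner_add_left, inner_add_right, inner_sub_left, inner_sub_right]
    ring
  have b1 : ‖⟪x - y', π a (x + y')⟫_ℂ‖ ≤ ‖x - y'‖ * ‖x + y'‖ * ‖a‖ :=
    (norm_inner_le_norm _ _).trans ((mul_le_mul_of_nonneg_left (norm_rep_le π a _)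
      (norm_nonneg _)).trans_eq (by ring))
  have b2 : ‖⟪x + y', π a (x - y')⟫_ℂ‖ ≤ ‖x - y'‖ * ‖x + y'‖ * ‖a‖ :=
    (norm_inner_le_norm _ _).trans ((mul_le_mul_of_nonneg_left (norm_rep_le π a _)
      (norm_nonneg _)).trans_eq (by ring))
  rw [e, norm_mul, norm_inv, Complex.norm_ofNat]
  have := norm_add_le (⟪x - y', π a (x + y')⟫_ℂ) (⟪x + y', π a (x - y')⟫_ℂ)
  linarith

/-! ### Orthogonality versus unitary equivalence -/

section PureStates

variable {A : Type u} [CStarAlgebra A]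

theorem norm_eq_one_of_mem_states {ω : StrongDual ℂ A} (hω : ω ∈ states A) : ‖ω‖ = 1 := by
  obtain ⟨G⟩ := nonempty_cyclicRep hω
  refine le_antisymm (ContinuousLinearMap.opNorm_le_bound _ zero_le_one fun a => ?_) ?_
  · rw [G.apply_eq, one_mul]
    have := norm_rep_le G.rep a G.vec
    rw [G.norm_vec hω, mul_one] at this
    refine (norm_inner_le_norm _ _).trans ?_
    rwa [G.norm_vec hω, one_mul]
  · have : Nontrivial A := by
      refine ⟨1, 0, fun h => ?_⟩
      have := hω.2
      rw [h, map_zero] at this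
      exact zero_ne_one this
    have h := ω.le_opNorm 1
    rwa [hω.2, CStarRing.norm_one, CStarRing.norm_one, mul_one] at h

theorem orthogonal_iff {ω₀ ω₁ : pureStates A} :
    Orthogonal ω₀ ω₁ ↔ ‖(ω₀ : StrongDual ℂ A) - (ω₁ : StrongDual ℂ A)‖ = 2 := by
  rw [Orthogonal, norm_eq_one_of_mem_states ω₀.2.1, norm_eq_one_of_mem_states ω₁.2.1,
    one_add_one_eq_two]

theorem norm_sub_le_two (ω₀ ω₁ : pureStates A) :
    ‖(ω₀ : StrongDual ℂ A) - (ω₁ : StrongDual ℂ A)‖ ≤ 2 := by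
  refine (norm_sub_le _ _).trans ?_
  rw [norm_eq_one_of_mem_states ω₀.2.1, norm_eq_one_of_mem_states ω₁.2.1]
  norm_num

/-- A vector state of the GNS representation of a pure state is unitarily equivalent to it. -/
theorem CyclicRep.exists_unitary_vector {ω : StrongDual ℂ A} (hω : ω ∈ pureStates A)
    (G : CyclicRep ω) {y : G.space} (hy : ‖y‖ = 1) :
    ∃ U ∈ unitary A, ∀ a, ω (star U * a * U) = ⟪y, G.rep a y⟫_ℂ := by
  obtain ⟨U, hU, c, hc, h⟩ := (G.isIrreducible hω).exists_unitary (G.norm_vec hω.1) hy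
  refine ⟨U, hU, fun a => ?_⟩
  have hcc : (starRingEnd ℂ) c * c = 1 := by
    rw [mul_comm, Complex.mul_conj, Complex.normSq_eq_norm_sq, hc]; simp
  rw [G.apply_eq, mul_assoc, map_mul, mul_apply_eq_comp, ← inner_rep_apply, map_mul,
    mul_apply_eq_comp, h, map_smul, inner_smul_left, inner_smul_right, ← mul_assoc, hcc, one_mul]

/-- Pure states at distance less than two are unitarily equivalent. -/
theorem unitarilyEquivalent_of_not_orthogonal {ω₀ ω₁ : pureStates A} (h : ¬ Orthogonal ω₀ ω₁) :
    UnitarilyEquivalent ω₀ ω₁ := by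
  let ω : Bool → pureStates A := fun b => bif b then ω₀ else ω₁
  let G : ∀ b, CyclicRep (ω b : StrongDual ℂ A) := fun b =>
    (nonempty_cyclicRep (ω b).2.1).some
  have hnot : ¬ 2 ≤ ‖(ω true : StrongDual ℂ A) - (ω false : StrongDual ℂ A)‖ := fun h2 =>
    h (orthogonal_iff.2 (le_antisymm (norm_sub_le_two _ _) h2))
  -- Without such an intertwiner the distance would be 2. The direction of `V` is not controlled,
  -- hence the final case split using symmetry.
  have key : ∃ i j, ∃ V : (G i).space →L[ℂ] (G j).space, i ≠ j ∧
      Intertwines (G i).rep (G j).rep V ∧ V ≠ 0 := by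
    by_contra! hcon
    exact hnot (two_le_norm_sub_of_disjoint (fun b => (G b).rep) hcon
      (fun b => (ω b : StrongDual ℂ A)) (fun b => (G b).vec)
      (fun b => (G b).norm_vec (ω b).2.1) fun b => (G b).apply_eq)
  obtain ⟨i, j, V, hij, hV, hV0⟩ := key
  obtain ⟨y, hy, hya⟩ := exists_vector_of_intertwiner ((G j).isIrreducible (ω j).2) hV hV0
    ((G j).norm_vec (ω j).2.1)
  obtain ⟨U, hU, hUa⟩ := (G i).exists_unitary_vector (ω i).2 hy
  have hji : UnitarilyEquivalent (ω j) (ω i) :=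
    ⟨U, hU, fun a => by rw [hUa, hya, (G j).apply_eq]⟩
  cases i <;> cases j
  · exact absurd rfl hij
  · exact hji
  · exact hji.symm
  · exact absurd rfl hij

theorem exists_unit_inner_ne_zero {H : Type*} [NormedAddCommGroup H] [InnerProductSpace ℂ H]
    {x y : H} (hx : ‖x‖ = 1) (hy : ‖y‖ = 1) :
    ∃ z : H, ‖z‖ = 1 ∧ ⟪x, z⟫_ℂ ≠ 0 ∧ ⟪y, z⟫_ℂ ≠ 0 := by
  have hself : ∀ v : H, ‖v‖ = 1 → ⟪v, v⟫_ℂ = 1 := fun v hv => by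
    rw [inner_self_eq_norm_sq_to_K, hv]; simp
  by_cases h : ⟪y, x⟫_ℂ = 0
  · have h' : ⟪x, y⟫_ℂ = 0 := inner_eq_zero_symm.1 h
    have hxs : ⟪x, x + y⟫_ℂ = 1 := by rw [inner_add_right, hself x hx, h', add_zero]
    have hys : ⟪y, x + y⟫_ℂ = 1 := by rw [inner_add_right, hself y hy, h, zero_add]
    have h0 : x + y ≠ 0 := fun h0 => by
      rw [h0, inner_zero_right] at hxs
      exact zero_ne_one hxs
    have hn : (‖x + y‖ : ℂ)⁻¹ ≠ 0 := by simpa using h0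
    refine ⟨(‖x + y‖ : ℂ)⁻¹ • (x + y), norm_smul_inv_norm h0, ?_, ?_⟩
    · rwa [inner_smul_right, hxs, mul_one]
    · rwa [inner_smul_right, hys, mul_one]
  · exact ⟨x, hx, by rw [hself x hx]; exact one_ne_zero, h⟩

/-- Two unitarily equivalent pure states have a common non-orthogonal pure state in their
equivalence class. -/
theorem exists_fibre_not_orthogonal {ω ρ : pureStates A} (h : UnitarilyEquivalent ω ρ) :
    ∃ σ ∈ fibre ω, ¬ Orthogonal ω σ ∧ ¬ Orthogonal ρ σ := by
  obtain ⟨G⟩ := nonempty_cyclicRep ω.2.1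
  have hx : ‖G.vec‖ = 1 := G.norm_vec ω.2.1
  obtain ⟨U, hU, hρ⟩ := h.symm
  set y := G.rep U G.vec with hy
  have hρy : ∀ a, (ρ : StrongDual ℂ A) a = ⟪y, G.rep a y⟫_ℂ := fun a => by
    rw [← hρ, G.apply_eq, mul_assoc, map_mul, mul_apply_eq_comp, ← inner_rep_apply, map_mul,
      mul_apply_eq_comp]
  have hy1 : ‖y‖ = 1 := by
    have h1 := hρy 1
    rw [ρ.2.1.2, map_one, one_apply_eq_self, inner_self_eq_norm_sq_to_K] at h1
    have h2 : ((‖y‖ ^ 2 : ℝ) : ℂ) = (1 : ℝ) := by push_cast; exact h1.symm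
    exact (pow_eq_one_iff_of_nonneg (norm_nonneg _) two_ne_zero).1 (Complex.ofReal_injective h2)
  obtain ⟨z, hz, hxz, hyz⟩ := exists_unit_inner_ne_zero hx hy1
  obtain ⟨W, hW, hWa⟩ := G.exists_unitary_vector ω.2 hz
  let σ : pureStates A := ⟨conjFunctional W ω, conjFunctional_mem_pureStates hW ω.2⟩
  have hσ : ∀ a, (σ : StrongDual ℂ A) a = ⟪z, G.rep a z⟫_ℂ := fun a =>
    (conjFunctional_apply W _ a).trans (hWa a)
  refine ⟨σ, UnitarilyEquivalent.symm ⟨W, hW, fun a => (conjFunctional_apply W _ a).symm⟩, ?_, ?_⟩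
  · rw [orthogonal_iff]
    exact (norm_sub_lt_two_of_inner_ne_zero G.rep hx hz hxz G.apply_eq hσ).ne
  · rw [orthogonal_iff]
    exact (norm_sub_lt_two_of_inner_ne_zero G.rep hy1 hz hyz hρy hσ).ne

end PureStates

end PureStateMaps

theorem lemma2p9 {A B : Type*} [CStarAlgebra A] [CStarAlgebra B]
    (φ : PureStateMaps.pureStates B → PureStateMaps.pureStates A) :
    (PureStateMaps.IsCoOrthogonal φ ↔ PureStateMaps.IsLocallyCoOrthogonal φ) ∧
      (PureStateMaps.IsLocallyCoOrthogonal φ → PureStateMaps.IsFibrePreserving φ) := by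
  open PureStateMaps in
  refine ⟨⟨fun h _ ω₀ _ ω₁ _ => h ω₀ trivial ω₁ trivial, fun h ω₀ _ ω₁ _ hφ => ?_⟩, ?_⟩
  · by_contra hn
    -- A non-orthogonal pair already lies in one class, where the local hypothesis applies.
    exact hn (h ω₀ ω₀ (.refl ω₀) ω₁ (unitarilyEquivalent_of_not_orthogonal hn) hφ)
  · rintro h ω _ ⟨ρ, hρ, rfl⟩
    obtain ⟨σ, hσ, h1, h2⟩ := exists_fibre_not_orthogonal hρ
    have e1 : UnitarilyEquivalent (φ ω) (φ σ) :=
      unitarilyEquivalent_of_not_orthogonal fun ho => h1 (h ω ω (.refl ω) σ hσ ho)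
    have e2 : UnitarilyEquivalent (φ ρ) (φ σ) :=
      unitarilyEquivalent_of_not_orthogonal fun ho => h2 (h ω ρ hρ σ hσ ho)
    exact e1.trans e2.symm
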